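/- Let $K,D,M$ be integers with $D\ge 2$, $M\ge 1$ and $K\ge D+M$, let $\mathbb{F}_q$ be a finite field, and let $n\ge 1$. A server stores $K$ messages $X_1,\dots,X_K$, independent and uniformly distributed over $\mathbb{F}_q^n$. Independently of the messages, $S$ is uniform over the $M$-subsets of $\{1,\dots,K\}$ and, given $S$, $W$ is uniform over the $D$-subsets of $\{1,\dots,K\}$ disjoint from $S$. A user who knows $X_S=(X_i)_{i\in S}$ wants $X_W=(X_i)_{i\in W}$. A (scalar-)linear IPIR protocol lets the user send a query $Q$, which is a deterministic or stochastic function (with discrete distribution) of $(W,S)$, independent of the messages; the server returns the answer $A$, a finite list of linear combinations $\sum_{i=1}^K c_iX_i$ with coefficients $c_i\in\mathbb{F}_q$ determined by $Q$. It is required that 1. (individual privacy) $\mathbb{P}(i\in W\mid Q=Q_0)=D/K$ for every $i\in\{1,\dots,K\}$ and every query $Q_0$ of positive probability; 2. (recoverability) for every realization $(W,S)$, the demand $X_W$ is determined by $A$, $Q$ and $X_S$. The rate of the protocol is $H(X_W)/H(A)$, where $H$ denotes Shannon entropy, and the linear capacity is the supremum of the rates over all linear IPIR protocols. Then every linear IPIR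 protocol, for every $n\ge 1$, has rate at most $(D+M)/K$. Consequently the linear capacity is at most $(D+M)/K$. -/

import Mathlib

open scoped ENNReal

universe u v

noncomputable section

namespace IPIR

/-- Shannon entropy, in bits, of a discrete distribution, as an extended nonnegative real. -/
def entropy {α : Type*} (p : PMF α) : ℝ≥0∞ :=
  ∑' a, ENNReal.ofReal (Real.negMulLog (p a).toReal / Real.log 2)

/-- Probability of the event `E`. -/
def prob {α : Type*} (p : PMF α) (E : Set α) : ℝ≥0∞ := p.toOuterMeasure E

/-- Elementary conditional probability of `E` given `G`; used only when `G` has positive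
probability. -/
def condProb {α : Type*} (p : PMF α) (E G : Set α) : ℝ≥0∞ := prob p (E ∩ G) / prob p G

/-- The possible index sets of the side information: the `M`-subsets of the `K` indices. -/
abbrev SideSet (K M : ℕ) : Type := {S : Finset (Fin K) // S.card = M}

/-- The index sets of the demand that are possible next to `S`: the `D`-subsets disjoint
from `S`. -/
abbrev DemandSet {K : ℕ} (D : ℕ) (S : Finset (Fin K)) : Type :=
  {W : Finset (Fin K) // W.card = D ∧ Disjoint W S}

/-- A realization `(W, S)` of the index sets of the demand and of the side information. -/
structure Setting (K D M : ℕ) where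
  W : Finset (Fin K)
  S : Finset (Fin K)
  card_W : W.card = D
  card_S : S.card = M
  disjoint : Disjoint W S

theorem sideSet_nonempty {K D M : ℕ} (h : D + M ≤ K) : Nonempty (SideSet K M) := by
  obtain ⟨S, -, hS⟩ := Finset.exists_subset_card_eq
    (s := (Finset.univ : Finset (Fin K))) (n := M) (by simp; omega)
  exact ⟨⟨S, hS⟩⟩

theorem demandSet_nonempty {K D M : ℕ} (h : D + M ≤ K) (S : SideSet K M) :
    Nonempty (DemandSet D S.1) := by
  obtain ⟨W, hW, hc⟩ := Finset.exists_subset_card_eq (s := S.1ᶜ) (n := D)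
    (by rw [Finset.card_compl, S.2, Fintype.card_fin]; omega)
  exact ⟨⟨W, hc, (Finset.disjoint_left.2 fun _ hx => Finset.mem_compl.1 (hW hx))⟩⟩

/-- The uniform distribution of `S` over the `M`-subsets. -/
def sideLaw {K D M : ℕ} (h : D + M ≤ K) : PMF (SideSet K M) :=
  haveI := sideSet_nonempty h
  PMF.uniformOfFintype _

/-- The conditional distribution of `W` given `S`, uniform over the `D`-subsets disjoint
from `S`. -/
def demandLawGiven {K D M : ℕ} (h : D + M ≤ K) (S : SideSet K M) : PMF (DemandSet D S.1) :=
  haveI := demandSet_nonempty h S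
  PMF.uniformOfFintype _

/-- The joint distribution of `(W, S)`. -/
def prior {K D M : ℕ} (h : D + M ≤ K) : PMF (Setting K D M) :=
  (sideLaw h).bind fun S =>
    (demandLawGiven h S).map fun W => ⟨W.1, S.1, W.2.1, S.2, W.2.2⟩

/-- The contents of the server: `K` messages, each a vector of `n` symbols of `F`. -/
abbrev Messages (F : Type u) (n K : ℕ) : Type u := Fin K → Fin n → F

/-- The messages are independent and uniform: uniform distribution on all `K`-tuples. -/
def messageLaw (F : Type u) [Field F] [Fintype F] (n K : ℕ) : PMF (Messages F n K) :=
  PMF.uniformOfFintype _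

/-- The data of a scalar-linear protocol: a stochastic map from settings to queries, and, for
every query, the finite list of coefficient vectors of the linear combinations that the server
returns. Deterministic query maps are the case of point masses. The query alphabet is
arbitrary; in particular the query may be the list of coefficient vectors itself. The
coefficient vectors need not be linearly independent. -/
structure LinearScheme (F : Type u) (K D M : ℕ) where
  Query : Type v
  query : Setting K D M → PMF Query
  len : Query → ℕ
  coeff : (q : Query) → Fin (len q) → Fin K → F

/-- An answer: a finite list of vectors with `n` symbols. -/
abbrev Answer (F : Type u) (n : ℕ) : Type u := Σ L : ℕ, Fin L → Fin n → F

namespace LinearScheme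

variable {F : Type u} [Field F] {K D M : ℕ}

/-- The answer to the query `q`: the linear combinations `∑ i, c i • X i`, with scalar
coefficients acting on whole messages. -/
def answer (P : LinearScheme.{u, v} F K D M) (n : ℕ) (q : P.Query) (X : Messages F n K) :
    Answer F n :=
  ⟨P.len q, fun l => ∑ i, P.coeff q l i • X i⟩

/-- The joint distribution of `(W, S)`, the query and the messages: the messages are independent
of `(W, S)` and of the query. -/
def joint [Fintype F] (P : LinearScheme.{u, v} F K D M) (n : ℕ) (h : D + M ≤ K) :
    PMF (Setting K D M × P.Query × Messages F n K) :=
  (prior h).bind fun s => (P.query s).bind fun q =>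
    (messageLaw F n K).map fun X => (s, q, X)

/-- Individual privacy: given any query that occurs with positive probability, every message
index belongs to the demand with probability `D / K`. -/
def IndividuallyPrivate [Fintype F] (P : LinearScheme.{u, v} F K D M) (n : ℕ)
    (h : D + M ≤ K) : Prop :=
  ∀ q : P.Query, prob (P.joint n h) {x | x.2.1 = q} ≠ 0 →
    ∀ i : Fin K, condProb (P.joint n h) {x | i ∈ x.1.W} {x | x.2.1 = q} = (D : ℝ≥0∞) / K

/-- Recoverability: for each `(W, S)` there is a decoder that computes the demanded messages from
the query, the answer and the side information, for every query that the user may send and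
all contents of the server. The decoder need not be linear. -/
def Recoverable (P : LinearScheme.{u, v} F K D M) (n : ℕ) : Prop :=
  ∀ s : Setting K D M,
    ∃ decode : P.Query → Answer F n → (s.S → Fin n → F) → (s.W → Fin n → F),
      ∀ q ∈ (P.query s).support, ∀ X : Messages F n K,
        decode q (P.answer n q X) (fun j : s.S => X j) = fun i : s.W => X i

/-- A linear protocol for individually-private retrieval with messages of `n` symbols. -/
def IsProtocol [Fintype F] (P : LinearScheme.{u, v} F K D M) (n : ℕ) (h : D + M ≤ K) : Prop :=
  P.IndividuallyPrivate n h ∧ P.Recoverable n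

/-- The distribution of the demand `X_W`, listed in increasing order of the indices. -/
def demandLaw [Fintype F] (P : LinearScheme.{u, v} F K D M) (n : ℕ) (h : D + M ≤ K) :
    PMF (Fin D → Fin n → F) :=
  (P.joint n h).map fun x k => x.2.2 (x.1.W.orderEmbOfFin x.1.card_W k)

/-- The distribution of the answer. -/
def answerLaw [Fintype F] (P : LinearScheme.{u, v} F K D M) (n : ℕ) (h : D + M ≤ K) :
    PMF (Answer F n) :=
  (P.joint n h).map fun x => P.answer n x.2.1 x.2.2

/-- The download rate: entropy of the demand divided by entropy of the answer. -/
def rate [Fintype F] (P : LinearScheme.{u, v} F K D M) (n : ℕ) (h : D + M ≤ K) : ℝ≥0∞ :=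
  entropy (P.demandLaw n h) / entropy (P.answerLaw n h)

end LinearScheme

/-- The linear capacity over the field `F`: the supremum of the rates of all linear protocols,
with any positive number `n` of symbols per message. -/
def linearCapacity (F : Type u) [Field F] [Fintype F] {K D M : ℕ} (h : D + M ≤ K) : ℝ≥0∞ :=
  ⨆ (n : ℕ) (_ : 1 ≤ n) (P : LinearScheme.{u, v} F K D M) (_ : P.IsProtocol n h), P.rate n h

end IPIR

end

/-!
Fix a query `q` of positive probability, let `N ⊆ F ^ K` be the space of vectors annihilated by
the coefficient vectors of its answer, and let `k = dim N`. The answer to `q` takes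
`|F| ^ (n (K - k))` equally likely values, so the heart of the matter is `k ≤ K M / (D + M)`.

Recoverability says that on `N` the coordinate functionals of `W` lie in the span of those of `S`,
for each `(W, S)` that may send `q` (`Recoverable.eq_zero`). Let `r(T)` be the rank on `N` of the
functionals indexed by `T`, a submodular function with `r(univ) = k`. There are weights
`w ≥ 0` on the indices, depending on `r` only, with `∑ w = k` and `∑_W w ≤ D M / (D + M)` for
all such `W` (`exists_weights_sum_le`). By privacy every index is demanded with probability `D / K`
given `q`, so averaging `∑_W w` over the demand gives `(D / K) k ≤ D M / (D + M)`
(`IndividuallyPrivate.sum_le`).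

The weights are the densities of the principal partition of `r` (`exists_balanced_weights`):
repeatedly contract the set with the least rank per element and use that ratio as the weight.
Contracting a sublevel set `{w ≤ t}` leaves `W` spanned by `S`, so `∑ w ≤ #(S ∩ {w > t})` over the
part of `W ∪ S` where `w > t`. Summing these inequalities with suitable multipliers yields
`∑_W w / (1 - w) ≤ M`, and convexity of `x / (1 - x)` gives the claim; the proof uses the tangent
line at `M / (D + M)` directly, which avoids the pole at `1`.

As the bound on `k` holds for every query, no answer has probability above
`|F| ^ (-n K D / (D + M))`. The entropy of the answer is at least its min-entropy, and that of the
demand is at most `n D log |F|`.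
-/

/-! ### Balanced weights for submodular functions -/

/-- Balanced weights for a submodular function `r`. If every `B ⊇ A` has average growth
`(r B - r A) / #(B \ A)` at least `t`, there are weights at least `t` off `A`, of total
`r univ - r A`, bounded on every set by the growth of `r`, and such that a set `W` spanned by `S`
satisfies `∑_W w c(w) ≤ ∑_S (1 - w) c(w)` for every monotone `c ≥ 0`.

The weights are those of the principal partition: a minimizer `A'` of the average growth gets
that average as its weight, and the construction goes on from `A'`, where no weight is smaller.
The bound on `W ∪ S` holds at every stage of the construction, and the statement about `c`
collects these bounds by Abel summation. The spanning hypothesis says that adding `W ∪ S` to any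
set `B` raises `r` by at most `#(S \ B)`. -/
theorem exists_balanced_weights {E : Type*} [Fintype E] [DecidableEq E] (r : Finset E → ℝ)
    (hsub : ∀ A B, r (A ∪ B) + r (A ∩ B) ≤ r A + r B) (A : Finset E) (t : ℝ)
    (ht : ∀ B, A ⊆ B → t * (B \ A).card ≤ r B - r A) :
    ∃ w : E → ℝ, (∀ i ∉ A, t ≤ w i) ∧ ∑ i ∈ Finset.univ \ A, w i = r Finset.univ - r A ∧
      (∀ T, ∑ i ∈ T \ A, w i ≤ r (A ∪ T) - r A) ∧
      ∀ W S : Finset E, Disjoint W S → (∀ B, r (B ∪ (W ∪ S)) ≤ r B + (S \ B).card) →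
        ∀ c : ℝ → ℝ, Monotone c → (∀ x, 0 ≤ c x) →
          ∑ i ∈ W \ A, w i * c (w i) ≤ ∑ i ∈ S \ A, (1 - w i) * c (w i) := by
  induction hm : (Finset.univ \ A).card using Nat.strong_induction_on generalizing A t with
  | _ m ih =>
  subst hm
  by_cases hA : A = Finset.univ
  · subst hA
    refine ⟨fun _ => 0, by simp, by simp,
      fun T => by simp [Finset.union_eq_left.2 (Finset.subset_univ T)], fun W S _ _ c _ _ => ?_⟩
    simp [Finset.sdiff_eq_empty_iff_subset.2 (Finset.subset_univ _)]
  -- `A'` has the least average growth of `r` over `A`; this average is the weight on `A' \ A`.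
  obtain ⟨A', hA', hmin⟩ := Finset.exists_min_image
    (Finset.univ.filter fun B : Finset E => A ⊂ B)
    (fun B => (r B - r A) / (B \ A).card)
    ⟨Finset.univ, by simpa [Finset.ssubset_univ_iff] using hA⟩
  replace hA' : A ⊂ A' := by simpa using hA'
  have hpos : ∀ B, A ⊂ B → (0 : ℝ) < (B \ A).card := fun B hB => by
    exact_mod_cast Finset.card_pos.2 (Finset.sdiff_nonempty.2 hB.2)
  set l : ℝ := (r A' - r A) / (A' \ A).card with hl
  have hlA' : l * (A' \ A).card = r A' - r A := div_mul_cancel₀ _ (hpos A' hA').ne'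
  have hlB : ∀ B, A ⊆ B → l * (B \ A).card ≤ r B - r A := by
    intro B hB
    rcases hB.eq_or_ssubset with rfl | hB
    · simp
    · exact (le_div_iff₀ (hpos B hB)).1 (hmin B (by simpa using hB))
  have htl : t ≤ l := (le_div_iff₀ (hpos A' hA')).2 (ht A' hA'.1)
  have hcard : ∀ B, A' ⊆ B → ((B \ A).card : ℝ) = (A' \ A).card + (B \ A').card := by
    intro B hB
    have h1 := Finset.card_sdiff_of_subset (hA'.1.trans hB)
    have h2 := Finset.card_sdiff_of_subset hA'.1
    have h3 := Finset.card_sdiff_of_subset hB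
    have h4 := Finset.card_le_card hA'.1
    have h5 := Finset.card_le_card hB
    norm_cast
    omega
  obtain ⟨v, hv, hvsum, hvT, hvc⟩ := ih _
    (by
      apply Finset.card_lt_card
      rw [Finset.ssubset_iff_subset_ne]
      refine ⟨Finset.sdiff_subset_sdiff le_rfl hA'.1, fun h => hA'.2 ?_⟩
      intro x hx
      by_contra hxA
      have : x ∈ Finset.univ \ A' := by rw [h]; simpa using hxA
      simp [hx] at this) A' l
    (by
      intro B hB
      have h1 := hlB B (hA'.1.trans hB)
      rw [hcard B hB] at h1
      linarith) rfl
  have split : ∀ (T : Finset E) (f : E → ℝ),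
      ∑ i ∈ T \ A, f i = ∑ i ∈ (T ∩ A') \ A, f i + ∑ i ∈ T \ A', f i := by
    intro T f
    rw [← Finset.sum_union]
    · congr 1
      ext i
      have := @hA'.1 i
      simp only [Finset.mem_union, Finset.mem_sdiff, Finset.mem_inter]
      tauto
    · rw [Finset.disjoint_left]
      intro i
      simp only [Finset.mem_sdiff, Finset.mem_inter]
      tauto
  have inner : ∀ (T : Finset E) (f g : E → ℝ), (∀ i ∈ A', f i = g i) →
      ∑ i ∈ (T ∩ A') \ A, f i = ∑ i ∈ (T ∩ A') \ A, g i := fun T f g h =>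
    Finset.sum_congr rfl fun i hi => h i (by simp at hi; exact hi.1.2)
  have outer : ∀ (T : Finset E) (f g : E → ℝ), (∀ i ∉ A', f i = g i) →
      ∑ i ∈ T \ A', f i = ∑ i ∈ T \ A', g i := fun T f g h =>
    Finset.sum_congr rfl fun i hi => h i (by simp at hi; exact hi.2)
  set w : E → ℝ := fun i => if i ∈ A' then l else v i with hw
  have win : ∀ i ∈ A', w i = l := fun i hi => by simp [hw, hi]
  have wout : ∀ i ∉ A', w i = v i := fun i hi => by simp [hw, hi]
  have hT : ∀ T, ∑ i ∈ T \ A, w i ≤ r (A ∪ T) - r A := by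
    intro T
    rw [split, inner T w (fun _ => l) win, outer T w v wout]
    have h1 := hvT T
    have h2 := hlB (A ∪ T ∩ A') Finset.subset_union_left
    have h3 := hsub A' (A ∪ T)
    have e1 : A' ∪ (A ∪ T) = A' ∪ T := by
      rw [← Finset.union_assoc, Finset.union_eq_left.2 hA'.1]
    have e2 : A' ∩ (A ∪ T) = A ∪ T ∩ A' := by
      rw [Finset.inter_union_distrib_left, Finset.inter_eq_right.2 hA'.1, Finset.inter_comm A' T]
    have e3 : (A ∪ T ∩ A') \ A = (T ∩ A') \ A := by
      rw [Finset.union_sdiff_left]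
    rw [e1, e2] at h3
    rw [e3] at h2
    simp only [Finset.sum_const, nsmul_eq_mul]
    linarith
  refine ⟨w, ?_, ?_, hT, ?_⟩
  · intro i hi
    by_cases h : i ∈ A'
    · rw [win i h]; exact htl
    · rw [wout i h]; exact htl.trans (hv i h)
  · rw [split, inner _ w (fun _ => l) win, outer _ w v wout, hvsum]
    simp only [Finset.univ_inter, Finset.sum_const, nsmul_eq_mul]
    linarith
  · intro W S hWS hspan c hc hc0
    -- Abel summation: `c = c l + (c - c l)`, where the constant part is governed by the bound at
    -- `A` and the remainder, which vanishes on `A'`, by the induction hypothesis.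
    have h1 := hvc W S hWS hspan (fun x => max 0 (c x - c l))
      (fun x y hxy => max_le_max le_rfl (sub_le_sub_right (hc hxy) _)) fun x => le_max_left _ _
    have hmax : ∀ i ∉ A', max 0 (c (v i) - c l) = c (v i) - c l := fun i hi =>
      max_eq_right (sub_nonneg.2 (hc (hv i hi)))
    have h2 : ∑ i ∈ W \ A, w i ≤ ∑ i ∈ S \ A, (1 - w i) := by
      have h3 := (hT (W ∪ S)).trans (sub_le_iff_le_add'.2 (hspan A))
      rw [Finset.union_sdiff_distrib, Finset.sum_union
        (hWS.mono Finset.sdiff_subset Finset.sdiff_subset)] at h3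
      rw [Finset.sum_sub_distrib, Finset.sum_const, nsmul_eq_mul, mul_one]
      linarith
    have h4 := mul_le_mul_of_nonneg_left h2 (hc0 l)
    rw [Finset.mul_sum, Finset.mul_sum, split W, split S,
      inner W _ (fun _ => c l * l) (fun i hi => by rw [win i hi]),
      inner S _ (fun _ => c l * (1 - l)) (fun i hi => by rw [win i hi]),
      outer W _ (fun i => c l * v i) (fun i hi => by rw [wout i hi]),
      outer S _ (fun i => c l * (1 - v i)) (fun i hi => by rw [wout i hi])] at h4
    rw [outer W _ (fun i => v i * (c (v i)) - c l * v i)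
        (fun i hi => by simp only [hmax i hi]; ring),
      outer S _ (fun i => (1 - v i) * (c (v i)) - c l * (1 - v i))
        (fun i hi => by simp only [hmax i hi]; ring),
      Finset.sum_sub_distrib, Finset.sum_sub_distrib] at h1
    rw [split W, split S,
      inner W _ (fun _ => c l * l) (fun i hi => by rw [win i hi, mul_comm]),
      inner S _ (fun _ => c l * (1 - l)) (fun i hi => by rw [win i hi, mul_comm]),
      outer W _ (fun i => v i * c (v i)) (fun i hi => by rw [wout i hi]),
      outer S _ (fun i => (1 - v i) * c (v i)) (fun i hi => by rw [wout i hi])]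
    linarith

/-- Balanced weights give every `D`-set that is spanned by `M` other elements a total of at most
`D * M / (D + M)`. -/
theorem exists_weights_sum_le {E : Type*} [Fintype E] [DecidableEq E] (r : Finset E → ℝ)
    (hsub : ∀ A B, r (A ∪ B) + r (A ∩ B) ≤ r A + r B) (hr0 : r ∅ = 0) (hr : ∀ A, 0 ≤ r A)
    {D M : ℕ} (hD : 0 < D) :
    ∃ w : E → ℝ, (∀ i, 0 ≤ w i) ∧ ∑ i, w i = r Finset.univ ∧
      ∀ W S : Finset E, W.card = D → S.card = M → Disjoint W S →
        (∀ B, r (B ∪ (W ∪ S)) ≤ r B + (S \ B).card) →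
          ∑ i ∈ W, w i ≤ D * M / (D + M) := by
  obtain ⟨w, hw, hsum, -, hwc⟩ := exists_balanced_weights r hsub ∅ 0
    (fun B _ => by simpa [hr0] using hr B)
  refine ⟨w, fun i => hw i (by simp), by simpa [hr0] using hsum, fun W S hW hS hWS hspan => ?_⟩
  have hD' : (0 : ℝ) < D := by exact_mod_cast hD
  have hM' : (0 : ℝ) ≤ M := by positivity
  -- `x * c x` is the positive part of `D ^ 2` times the tangent line of the convex function
  -- `x / (1 - x)` at `x = M / (D + M)`, so that `(1 - x) * c x ≤ D ^ 2`. The case `x ≤ 0` is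
  -- separate because `M ^ 2 / 0 = 0` would break monotonicity at `0`.
  let c : ℝ → ℝ := fun x => if x ≤ 0 then 0 else max 0 (((D : ℝ) + M) ^ 2 - (M : ℝ) ^ 2 / x)
  have hc0 : ∀ x, 0 ≤ c x := fun x => by
    simp only [c]
    split_ifs
    exacts [le_rfl, le_max_left _ _]
  have hcmono : Monotone c := by
    intro x y hxy
    by_cases hx : x ≤ 0
    · simpa only [c, if_pos hx] using hc0 y
    · have hy : ¬ y ≤ 0 := by linarith
      simp only [c, if_neg hx, if_neg hy]
      refine max_le_max le_rfl (sub_le_sub_left ?_ _)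
      push Not at hx
      gcongr
  have hlow : ∀ x, 0 ≤ x → ((D : ℝ) + M) ^ 2 * x - (M : ℝ) ^ 2 ≤ x * c x := by
    intro x hx
    rcases hx.eq_or_lt with rfl | hx
    · simp only [mul_zero, zero_mul]
      nlinarith [sq_nonneg (M : ℝ)]
    · simp only [c, if_neg hx.not_ge]
      calc _ = x * (((D : ℝ) + M) ^ 2 - (M : ℝ) ^ 2 / x) := by field_simp
        _ ≤ _ := mul_le_mul_of_nonneg_left (le_max_right _ _) hx.le
  have hup : ∀ x, 0 ≤ x → (1 - x) * c x ≤ (D : ℝ) ^ 2 := by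
    intro x hx
    by_cases hx1 : 1 ≤ x
    · nlinarith [hc0 x, sq_nonneg (D : ℝ)]
    push Not at hx1
    rcases hx.eq_or_lt with rfl | hx
    · simp only [c, le_refl, if_true, mul_zero]; positivity
    simp only [c, if_neg hx.not_ge]
    rw [mul_max_of_nonneg _ _ (sub_nonneg.2 hx1.le), mul_zero]
    refine max_le (by positivity) ?_
    have : (D : ℝ) ^ 2 - (1 - x) * (((D : ℝ) + M) ^ 2 - (M : ℝ) ^ 2 / x)
        = ((D + M) * x - M) ^ 2 / x := by
      field_simp
      ring
    have h2 : 0 ≤ ((D + M) * x - M) ^ 2 / x := by positivity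
    linarith
  have key := hwc W S hWS hspan c hcmono hc0
  rw [Finset.sdiff_empty, Finset.sdiff_empty] at key
  have h1 : ∑ i ∈ W, (((D : ℝ) + M) ^ 2 * w i - (M : ℝ) ^ 2) ≤ ∑ i ∈ W, w i * c (w i) :=
    Finset.sum_le_sum fun i _ => hlow _ (hw i (by simp))
  have h2 : ∑ i ∈ S, (1 - w i) * c (w i) ≤ ∑ i ∈ S, (D : ℝ) ^ 2 :=
    Finset.sum_le_sum fun i _ => hup _ (hw i (by simp))
  rw [Finset.sum_sub_distrib, ← Finset.mul_sum, Finset.sum_const, nsmul_eq_mul, hW] at h1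
  rw [Finset.sum_const, nsmul_eq_mul, hS] at h2
  rw [le_div_iff₀ (by positivity)]
  have h3 : ((D : ℝ) + M) * ((∑ i ∈ W, w i) * (D + M)) ≤ (D + M) * (D * M) := by
    nlinarith
  exact le_of_mul_le_mul_left h3 (by positivity)

/-! ### Rank of coordinate functionals on a subspace -/

namespace Submodule

variable {F : Type*} [Field F] {ι : Type*}

/-- The rank of the restrictions to `N` of the coordinate functionals indexed by `T`, encoded as
the codimension in `N` of the vectors that vanish on `T`. -/
noncomputable def coordRank (N : Submodule F (ι → F)) (T : Finset ι) : ℝ :=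
  Module.finrank F N -
    Module.finrank F (N ⊓ Submodule.pi (T : Set ι) fun _ => ⊥ : Submodule F (ι → F))

theorem coordRank_empty (N : Submodule F (ι → F)) : N.coordRank ∅ = 0 := by
  have : (N ⊓ Submodule.pi ((∅ : Finset ι) : Set ι) fun _ => ⊥ : Submodule F (ι → F)) = N := by
    ext x; simp
  rw [coordRank, this, sub_self]

variable [Fintype ι]

theorem coordRank_nonneg (N : Submodule F (ι → F)) (T : Finset ι) : 0 ≤ N.coordRank T :=
  sub_nonneg.2 (by exact_mod_cast Submodule.finrank_mono (inf_le_left : N ⊓ _ ≤ N))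

theorem coordRank_univ (N : Submodule F (ι → F)) :
    N.coordRank Finset.univ = Module.finrank F N := by
  have : (N ⊓ Submodule.pi ((Finset.univ : Finset ι) : Set ι) fun _ => ⊥ : Submodule F (ι → F))
      = ⊥ := by
    rw [Submodule.eq_bot_iff]
    rintro x ⟨-, hx⟩
    ext i
    simpa using hx i (by simp)
  rw [coordRank, this, finrank_bot, Nat.cast_zero, sub_zero]

theorem coordRank_union_add_inter_le [DecidableEq ι] (N : Submodule F (ι → F)) (A B : Finset ι) :
    N.coordRank (A ∪ B) + N.coordRank (A ∩ B) ≤ N.coordRank A + N.coordRank B := by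
  have h := Submodule.finrank_sup_add_finrank_inf_eq
    (N ⊓ Submodule.pi (A : Set ι) fun _ => ⊥ : Submodule F (ι → F))
    (N ⊓ Submodule.pi (B : Set ι) fun _ => ⊥ : Submodule F (ι → F))
  have h1 := Submodule.finrank_mono (R := F)
    (s := (N ⊓ Submodule.pi (A : Set ι) fun _ => ⊥) ⊔ (N ⊓ Submodule.pi (B : Set ι) fun _ => ⊥))
    (t := N ⊓ Submodule.pi ((A ∩ B : Finset ι) : Set ι) fun _ => ⊥)
    (sup_le (fun x hx => ⟨hx.1, fun i hi => hx.2 i (by simp at hi; exact hi.1)⟩)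
      (fun x hx => ⟨hx.1, fun i hi => hx.2 i (by simp at hi; exact hi.2)⟩))
  have h2 : (N ⊓ Submodule.pi (A : Set ι) fun _ => ⊥) ⊓ (N ⊓ Submodule.pi (B : Set ι) fun _ => ⊥)
      = (N ⊓ Submodule.pi ((A ∪ B : Finset ι) : Set ι) fun _ => ⊥ : Submodule F (ι → F)) := by
    ext x
    simp only [Submodule.mem_inf, Submodule.mem_pi, Finset.coe_union, Set.mem_union]
    constructor
    · rintro ⟨⟨h1, h2⟩, -, h3⟩
      exact ⟨h1, fun i hi => hi.elim (h2 i) (h3 i)⟩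
    · rintro ⟨h1, h2⟩
      exact ⟨⟨h1, fun i hi => h2 i (Or.inl hi)⟩, h1, fun i hi => h2 i (Or.inr hi)⟩
  rw [h2] at h
  simp only [coordRank]
  have h3 : (Module.finrank F (N ⊓ Submodule.pi (A : Set ι) fun _ => ⊥ : Submodule F (ι → F)) : ℝ)
      + Module.finrank F (N ⊓ Submodule.pi (B : Set ι) fun _ => ⊥ : Submodule F (ι → F)) ≤
      Module.finrank F (N ⊓ Submodule.pi ((A ∩ B : Finset ι) : Set ι) fun _ => ⊥ :
        Submodule F (ι → F)) +
      Module.finrank F (N ⊓ Submodule.pi ((A ∪ B : Finset ι) : Set ι) fun _ => ⊥ :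
        Submodule F (ι → F)) := by
    exact_mod_cast (by omega)
  linarith

theorem coordRank_le_card (N : Submodule F (ι → F)) (T : Finset ι) : N.coordRank T ≤ T.card := by
  let f : N →ₗ[F] (T → F) := (LinearMap.funLeft F F (Subtype.val : T → ι)).comp N.subtype
  have h1 := f.finrank_range_add_finrank_ker
  have h2 : Module.finrank F (LinearMap.range f) ≤ T.card := by
    simpa using Submodule.finrank_le (LinearMap.range f)
  have h3 : Module.finrank F (LinearMap.ker f) ≤
      Module.finrank F (N ⊓ Submodule.pi (T : Set ι) fun _ => ⊥ : Submodule F (ι → F)) := by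
    rw [← Submodule.finrank_map_subtype_eq]
    refine Submodule.finrank_mono ?_
    rintro _ ⟨x, hx, rfl⟩
    exact ⟨x.2, fun i hi => by
      have hxi : x.1 i = 0 := congrFun (LinearMap.mem_ker.1 hx) ⟨i, hi⟩
      simpa using hxi⟩
  have h4 : (Module.finrank F N : ℝ) ≤ T.card +
      Module.finrank F (N ⊓ Submodule.pi (T : Set ι) fun _ => ⊥ : Submodule F (ι → F)) := by
    exact_mod_cast (by omega)
  rw [coordRank]
  linarith

/-- If a vector of `N` that vanishes on `S` vanishes on `W`, then the functionals of `W` do not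
contribute to the rank next to those of `S`. -/
theorem coordRank_union_le [DecidableEq ι] (N : Submodule F (ι → F)) {W S : Finset ι}
    (h : ∀ x ∈ N, (∀ i ∈ S, x i = 0) → ∀ i ∈ W, x i = 0) (B : Finset ι) :
    N.coordRank (B ∪ (W ∪ S)) ≤ N.coordRank B + (S \ B).card := by
  have h1 : N.coordRank (B ∪ (W ∪ S)) ≤ N.coordRank (B ∪ S \ B) := by
    refine sub_le_sub_left ?_ _
    norm_cast
    refine Submodule.finrank_mono fun x hx => ⟨hx.1, fun i hi => ?_⟩
    have hBS : ∀ i, i ∈ B ∨ i ∈ S → x i = 0 := fun i hi => by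
      simpa using hx.2 i (by simpa using hi)
    have hi : i ∈ B ∨ i ∈ W ∨ i ∈ S := by simpa using hi
    rcases hi with hi | hi | hi
    · exact hBS i (Or.inl hi)
    · exact h x hx.1 (fun j hj => hBS j (Or.inr hj)) i hi
    · exact hBS i (Or.inr hi)
  have h2 := N.coordRank_union_add_inter_le B (S \ B)
  have h3 := N.coordRank_nonneg (B ∩ (S \ B))
  have h4 := N.coordRank_le_card (S \ B)
  linarith

end Submodule

/-! ### Entropy bounds -/

namespace IPIR

theorem prob_eq_tsum {α : Type*} (p : PMF α) (E : Set α) : prob p E = ∑' a, E.indicator p a :=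
  PMF.toOuterMeasure_apply p E

/-- Uniform laws maximize entropy. -/
theorem entropy_le_log_card {α : Type*} [Fintype α] [Nonempty α] (p : PMF α) :
    entropy p ≤ ENNReal.ofReal (Real.log (Fintype.card α) / Real.log 2) := by
  have hN : (0 : ℝ) < Fintype.card α := by exact_mod_cast Fintype.card_pos
  have h01 : ∀ a, 0 ≤ (p a).toReal ∧ (p a).toReal ≤ 1 := fun a =>
    ⟨ENNReal.toReal_nonneg,
      ENNReal.toReal_le_of_le_ofReal zero_le_one (by simpa using p.coe_le_one a)⟩
  have hsum : ∑ a, (p a).toReal = 1 := by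
    rw [← ENNReal.toReal_sum fun a _ => p.apply_ne_top a,
      ← tsum_fintype (L := .unconditional _), p.tsum_coe]
    rfl
  -- Gibbs' inequality, from `log x ≤ x - 1` at `x = 1 / (N p)`.
  have key : ∀ a, Real.negMulLog (p a).toReal ≤
      (p a).toReal * Real.log (Fintype.card α) + (1 / Fintype.card α - (p a).toReal) := by
    intro a
    rcases (h01 a).1.eq_or_lt with h | h
    · rw [← h]; simp
    · have h1 := Real.log_le_sub_one_of_pos (x := 1 / (Fintype.card α * (p a).toReal))
        (by positivity)
      rw [Real.log_div one_ne_zero (by positivity), Real.log_one,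
        Real.log_mul hN.ne' h.ne'] at h1
      have h2 := mul_le_mul_of_nonneg_left h1 h.le
      have h3 : (p a).toReal * (1 / (Fintype.card α * (p a).toReal) - 1) =
          1 / Fintype.card α - (p a).toReal := by field_simp
      rw [h3] at h2
      rw [Real.negMulLog]
      linarith
  have hl2 : 0 < Real.log 2 := Real.log_pos one_lt_two
  rw [entropy, tsum_fintype, ← ENNReal.ofReal_sum_of_nonneg fun a _ =>
    div_nonneg (Real.negMulLog_nonneg (h01 a).1 (h01 a).2) hl2.le]
  refine ENNReal.ofReal_le_ofReal ?_
  rw [← Finset.sum_div]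
  refine div_le_div_of_nonneg_right ((Finset.sum_le_sum fun a _ => key a).trans ?_) hl2.le
  rw [Finset.sum_add_distrib, ← Finset.sum_mul, Finset.sum_sub_distrib, hsum, Finset.sum_const,
    Finset.card_univ, nsmul_eq_mul, mul_one_div_cancel hN.ne']
  simp

/-- Shannon entropy is at least the min-entropy. -/
theorem le_entropy {α : Type*} (p : PMF α) (b : ℝ)
    (h : ∀ a, p a ≤ ENNReal.ofReal (Real.exp (-b))) :
    ENNReal.ofReal (b / Real.log 2) ≤ entropy p := by
  have hl2 : 0 < Real.log 2 := Real.log_pos one_lt_two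
  calc ENNReal.ofReal (b / Real.log 2)
      = ∑' a, p a * ENNReal.ofReal (b / Real.log 2) := by
        rw [ENNReal.tsum_mul_right, p.tsum_coe, one_mul]
    _ ≤ entropy p := by
      refine ENNReal.tsum_le_tsum fun a => ?_
      rcases eq_or_ne (p a) 0 with h0 | h0
      · simp [h0]
      have hpos : 0 < (p a).toReal := ENNReal.toReal_pos h0 (p.apply_ne_top a)
      have h1 : Real.log (p a).toReal ≤ -b := by
        rw [Real.log_le_iff_le_exp hpos]
        exact ENNReal.toReal_le_of_le_ofReal (Real.exp_pos _).le (h a)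
      rw [← ENNReal.ofReal_toReal (p.apply_ne_top a), ← ENNReal.ofReal_mul hpos.le,
        ENNReal.toReal_ofReal hpos.le]
      refine ENNReal.ofReal_le_ofReal ?_
      rw [← mul_div_assoc]
      refine div_le_div_of_nonneg_right ?_ hl2.le
      rw [Real.negMulLog]
      nlinarith

theorem bind_apply_le {α β : Type*} (p : PMF α) (f : α → PMF β) (b : β) (d : ℝ≥0∞)
    (h : ∀ a ∈ p.support, f a b ≤ d) : p.bind f b ≤ d := by
  rw [PMF.bind_apply]
  calc ∑' a, p a * f a b ≤ ∑' a, p a * d := by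
        refine ENNReal.tsum_le_tsum fun a => ?_
        by_cases ha : a ∈ p.support
        · exact mul_le_mul_right (h a ha) _
        · simp [(p.apply_eq_zero_iff a).2 ha]
    _ = d := by rw [ENNReal.tsum_mul_right, p.tsum_coe, one_mul]

/-! ### Linear schemes -/

namespace LinearScheme

variable {F : Type u} [Field F] {K D M : ℕ}

/-- The vectors annihilated by all the coefficient vectors of the answer to `q`. -/
def answerKer (P : LinearScheme.{u, v} F K D M) (q : P.Query) : Submodule F (Fin K → F) :=
  LinearMap.ker (Matrix.mulVecLin (Matrix.of (P.coeff q)))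

theorem mem_answerKer (P : LinearScheme.{u, v} F K D M) (q : P.Query) (x : Fin K → F) :
    x ∈ P.answerKer q ↔ ∀ l, ∑ i, P.coeff q l i * x i = 0 := by
  simp [answerKer, funext_iff, Matrix.mulVec, dotProduct]

theorem answer_eq_iff (P : LinearScheme.{u, v} F K D M) {n : ℕ} (q : P.Query)
    (X Y : Messages F n K) :
    P.answer n q X = P.answer n q Y ↔ ∀ j, (fun i => X i j - Y i j) ∈ P.answerKer q := by
  simp only [answer, mem_answerKer, Sigma.mk.injEq, heq_eq_eq, true_and, funext_iff,
    Finset.sum_apply, Pi.smul_apply, smul_eq_mul, mul_sub, Finset.sum_sub_distrib, sub_eq_zero]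
  exact forall_comm

/-- In a recoverable scheme, a single vector invisible in the answer and in the side information
is invisible in the demand. This needs no linearity of the decoder. -/
theorem Recoverable.eq_zero {P : LinearScheme.{u, v} F K D M} {n : ℕ} (hP : P.Recoverable n)
    (hn : 1 ≤ n) (s : Setting K D M) {q : P.Query} (hq : q ∈ (P.query s).support)
    {x : Fin K → F} (hx : x ∈ P.answerKer q) (hS : ∀ i ∈ s.S, x i = 0) : ∀ i ∈ s.W, x i = 0 := by
  obtain ⟨dec, hdec⟩ := hP s
  -- The contents `x` in each of the `n` symbols look the same to the user as the zero contents.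
  have h1 := hdec q hq fun i _ => x i
  have h2 := hdec q hq 0
  have h3 : P.answer n q (fun i _ => x i) = P.answer n q 0 :=
    (P.answer_eq_iff q _ _).2 fun j => by simpa using hx
  have h4 : (fun (j : s.S) (_ : Fin n) => x j) = fun j : s.S => (0 : Messages F n K) j := by
    funext j k
    simpa using hS j j.2
  rw [h3, h4, h2] at h1
  intro i hi
  simpa using (congrFun (congrFun h1 ⟨i, hi⟩) ⟨0, hn⟩).symm

theorem card_fiber_answer_le [Fintype F] (P : LinearScheme.{u, v} F K D M) {n : ℕ}
    (q : P.Query) (a : Answer F n) :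
    Nat.card {X : Messages F n K // P.answer n q X = a} ≤
      Fintype.card F ^ (n * Module.finrank F (P.answerKer q)) := by
  by_cases h : ∃ Y, P.answer n q Y = a
  · obtain ⟨Y, rfl⟩ := h
    let f : {X : Messages F n K // P.answer n q X = P.answer n q Y} → Fin n → P.answerKer q :=
      fun X j => ⟨_, (P.answer_eq_iff q _ _).1 X.2 j⟩
    have hf : Function.Injective f := by
      intro X X' h
      ext i j
      have := congrFun (congrArg Subtype.val (congrFun h j)) i
      simpa [f] using this
    refine (Nat.card_le_card_of_injective f hf).trans_eq ?_
    rw [Nat.card_fun, Module.natCard_eq_pow_finrank (K := F), Nat.card_eq_fintype_card,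
      Nat.card_eq_fintype_card, Fintype.card_fin, ← pow_mul, mul_comm]
  · have : IsEmpty {X : Messages F n K // P.answer n q X = a} := ⟨fun X => h ⟨X, X.2⟩⟩
    simp

variable [Fintype F]

/-- By privacy, averaging over the demand turns a bound for the weight of each demand set into one
for the total weight. -/
theorem IndividuallyPrivate.sum_le {P : LinearScheme.{u, v} F K D M} {n : ℕ} {h : D + M ≤ K}
    (hP : P.IndividuallyPrivate n h) (hD : 0 < D) {s₀ : Setting K D M}
    (hs₀ : s₀ ∈ (prior h).support)
    {q : P.Query} (hq : q ∈ (P.query s₀).support) (w : Fin K → ℝ) (hw : ∀ i, 0 ≤ w i) (b : ℝ)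
    (hb : ∀ s : Setting K D M, q ∈ (P.query s).support → ∑ i ∈ s.W, w i ≤ b) :
    D * ∑ i, w i ≤ K * b := by
  classical
  have hK : 0 < K := by omega
  set G : Set (Setting K D M × P.Query × Messages F n K) := {x | x.2.1 = q} with hG
  have hG0 : prob (P.joint n h) G ≠ 0 := by
    rw [prob, Ne, PMF.toOuterMeasure_apply_eq_zero_iff, Set.not_disjoint_iff]
    refine ⟨(s₀, q, 0), ?_, rfl⟩
    simp only [joint, PMF.mem_support_bind_iff, PMF.mem_support_map_iff]
    exact ⟨s₀, hs₀, q, hq, 0, by simp [messageLaw], rfl⟩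
  have hsupp : ∀ x ∈ (P.joint n h).support, x.2.1 ∈ (P.query x.1).support := by
    intro x hx
    simp only [joint, PMF.mem_support_bind_iff, PMF.mem_support_map_iff] at hx
    obtain ⟨s, -, q, hq, X, -, rfl⟩ := hx
    exact hq
  have hG1 : prob (P.joint n h) G ≠ ⊤ := by
    refine ne_top_of_le_ne_top ENNReal.one_ne_top ?_
    rw [prob_eq_tsum, ← (P.joint n h).tsum_coe]
    exact ENNReal.tsum_le_tsum fun x => Set.indicator_le_self _ _ x
  have hpr : ∀ i, prob (P.joint n h) ({x | i ∈ x.1.W} ∩ G) =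
      (D : ℝ≥0∞) / K * prob (P.joint n h) G := by
    intro i
    rw [← hP q hG0 i, condProb, ENNReal.div_mul_cancel hG0 hG1]
  have key : ∑ i, ENNReal.ofReal (w i) * prob (P.joint n h) ({x | i ∈ x.1.W} ∩ G) ≤
      ENNReal.ofReal b * prob (P.joint n h) G := by
    simp only [prob_eq_tsum, ← ENNReal.tsum_mul_left]
    rw [← Summable.tsum_finsetSum fun _ _ => ENNReal.summable]
    refine ENNReal.tsum_le_tsum fun x => ?_
    by_cases hx : x ∈ G
    · by_cases hxs : x ∈ (P.joint n h).support
      · have h1 : ∀ i, ENNReal.ofReal (w i) *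
            ({x | i ∈ x.1.W} ∩ G : Set _).indicator (P.joint n h) x =
            if i ∈ x.1.W then ENNReal.ofReal (w i) * P.joint n h x else 0 := by
          intro i
          by_cases hi : i ∈ x.1.W <;> simp [Set.indicator, hi, hx]
        simp only [h1, ← Finset.sum_filter, Finset.filter_mem_eq_inter, Finset.univ_inter]
        rw [← Finset.sum_mul, Set.indicator_of_mem hx,
          ← ENNReal.ofReal_sum_of_nonneg fun i _ => hw i]
        gcongr
        refine hb x.1 ?_
        have := hsupp x hxs
        rwa [show x.2.1 = q from hx] at this
      · have : P.joint n h x = 0 := (PMF.apply_eq_zero_iff _ _).2 hxs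
        simp [Set.indicator, this]
    · simp [hx]
  simp only [hpr] at key
  rw [← Finset.sum_mul, ← ENNReal.ofReal_sum_of_nonneg fun i _ => hw i, ← mul_assoc] at key
  have key2 := (ENNReal.mul_le_mul_iff_left hG0 hG1).1 key
  have hDK : (D : ℝ≥0∞) / K = ENNReal.ofReal ((D : ℝ) / K) := by
    rw [ENNReal.ofReal_div_of_pos (by exact_mod_cast hK), ENNReal.ofReal_natCast,
      ENNReal.ofReal_natCast]
  rw [hDK, ← ENNReal.ofReal_mul (Finset.sum_nonneg fun i _ => hw i), ENNReal.ofReal_le_ofReal_iff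
    ((Finset.sum_nonneg fun i _ => hw i).trans (hb s₀ hq))] at key2
  have hK' : (0 : ℝ) < K := by exact_mod_cast hK
  have := mul_le_mul_of_nonneg_left key2 hK'.le
  calc D * ∑ i, w i = K * ((∑ i, w i) * (D / K)) := by field_simp
    _ ≤ _ := this

/-- The rank bound behind the converse: the answer to a query leaves at most `K M / (D + M)`
dimensions undetermined. -/
theorem IsProtocol.finrank_answerKer_le {P : LinearScheme.{u, v} F K D M} {n : ℕ} {h : D + M ≤ K}
    (hP : P.IsProtocol n h) (hn : 1 ≤ n) (hD : 0 < D) {s₀ : Setting K D M}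
    (hs₀ : s₀ ∈ (prior h).support) {q : P.Query} (hq : q ∈ (P.query s₀).support) :
    (Module.finrank F (P.answerKer q) : ℝ) ≤ K * M / (D + M) := by
  obtain ⟨w, hw, hsum, hW⟩ := exists_weights_sum_le (P.answerKer q).coordRank
    (P.answerKer q).coordRank_union_add_inter_le (P.answerKer q).coordRank_empty
    (P.answerKer q).coordRank_nonneg (M := M) hD
  have h1 := hP.1.sum_le hD hs₀ hq w hw _ fun s hs => hW s.W s.S s.card_W s.card_S s.disjoint
    (Submodule.coordRank_union_le _ fun x hx => hP.2.eq_zero hn s hs hx)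
  rw [hsum, Submodule.coordRank_univ] at h1
  have hD' : (0 : ℝ) < D := by exact_mod_cast hD
  refine le_of_mul_le_mul_left (h1.trans_eq ?_) hD'
  ring

theorem map_answer_apply_le (P : LinearScheme.{u, v} F K D M) {n : ℕ} (q : P.Query)
    (a : Answer F n) :
    (messageLaw F n K).map (P.answer n q) a ≤ ENNReal.ofReal (Real.exp
      (-(n * (K - Module.finrank F (P.answerKer q)) * Real.log (Fintype.card F)))) := by
  classical
  have hF : (0 : ℝ) < Fintype.card F := by exact_mod_cast Fintype.card_pos
  have e : Real.exp (-(n * (K - Module.finrank F (P.answerKer q)) * Real.log (Fintype.card F))) =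
      (Fintype.card F : ℝ) ^ (n * Module.finrank F (P.answerKer q)) /
        (Fintype.card F : ℝ) ^ (K * n) := by
    rw [← Real.rpow_natCast, ← Real.rpow_natCast, ← Real.rpow_sub hF, Real.rpow_def_of_pos hF]
    push_cast
    ring_nf
  have h1 : (messageLaw F n K).map (P.answer n q) a =
      (Nat.card {X : Messages F n K // P.answer n q X = a} : ℝ≥0∞) /
        (Fintype.card F ^ (K * n) : ℕ) := by
    rw [← PMF.toOuterMeasure_apply_singleton, PMF.toOuterMeasure_map_apply, messageLaw,
      PMF.toOuterMeasure_uniformOfFintype_apply]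
    congr 2
    · rw [Nat.card_eq_fintype_card]
      exact Fintype.card_congr (Equiv.refl _)
    · simp [Messages, ← pow_mul, mul_comm]
  rw [h1, e, ENNReal.ofReal_div_of_pos (by positivity)]
  refine ENNReal.div_le_div ?_ ?_
  · rw [← Nat.cast_pow, ENNReal.ofReal_natCast]
    exact_mod_cast P.card_fiber_answer_le q a
  · rw [← Nat.cast_pow, ENNReal.ofReal_natCast]

theorem IsProtocol.le_entropy_answerLaw {P : LinearScheme.{u, v} F K D M} {n : ℕ} {h : D + M ≤ K}
    (hP : P.IsProtocol n h) (hn : 1 ≤ n) (hD : 0 < D) :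
    ENNReal.ofReal (n * (K * D / (D + M)) * Real.log (Fintype.card F) / Real.log 2) ≤
      entropy (P.answerLaw n h) := by
  refine le_entropy _ _ fun a => ?_
  have e : P.answerLaw n h = (prior h).bind fun s => (P.query s).bind fun q =>
      (messageLaw F n K).map (P.answer n q) := by
    simp only [answerLaw, joint, PMF.map_bind, PMF.map_comp]
    rfl
  rw [e]
  refine bind_apply_le _ _ _ _ fun s hs => bind_apply_le _ _ _ _ fun q hq =>
    (P.map_answer_apply_le q a).trans ?_
  have hk := hP.finrank_answerKer_le hn hD hs hq
  have hD' : (0 : ℝ) < D := by exact_mod_cast hD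
  have hl : 0 ≤ Real.log (Fintype.card F) := Real.log_natCast_nonneg _
  have hKD : (K : ℝ) * D / (D + M) = K - K * M / (D + M) := by
    field_simp
    ring
  gcongr
  linarith

theorem IsProtocol.rate_le {P : LinearScheme.{u, v} F K D M} {n : ℕ} {h : D + M ≤ K}
    (hP : P.IsProtocol n h) (hn : 1 ≤ n) (hD : 0 < D) : P.rate n h ≤ ((D : ℝ≥0∞) + M) / K := by
  have hD' : (0 : ℝ) < D := by exact_mod_cast hD
  have hK' : (0 : ℝ) < K := by exact_mod_cast (by omega : 0 < K)
  have e : ((D : ℝ≥0∞) + M) / K = ENNReal.ofReal (((D : ℝ) + M) / K) := by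
    rw [ENNReal.ofReal_div_of_pos hK', ENNReal.ofReal_add hD'.le (Nat.cast_nonneg _)]
    simp only [ENNReal.ofReal_natCast]
  refine ENNReal.div_le_of_le_mul ((entropy_le_log_card _).trans ?_)
  refine le_trans (le_of_eq ?_) (mul_le_mul_right (hP.le_entropy_answerLaw hn hD) _)
  rw [e, ← ENNReal.ofReal_mul (by positivity)]
  congr 1
  simp only [Fintype.card_fun, Fintype.card_fin, Nat.cast_pow, Real.log_pow]
  field_simp

end LinearScheme

end IPIR

theorem theorem1 (F : Type u) [Field F] [Fintype F] (K D M : ℕ)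
    (hD : 2 ≤ D) (hM : 1 ≤ M) (hK : D + M ≤ K) :
    (∀ n : ℕ, 1 ≤ n → ∀ P : IPIR.LinearScheme.{u, v} F K D M, P.IsProtocol n hK →
      P.rate n hK ≤ ((D : ENNReal) + M) / K) ∧
    IPIR.linearCapacity.{u, v} F hK ≤ ((D : ENNReal) + M) / K :=
  ⟨fun _ hn _ hP => hP.rate_le hn (by omega),
    iSup_le fun _ => iSup_le fun hn => iSup_le fun _ => iSup_le fun hP =>
      hP.rate_le hn (by omega)⟩
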